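/- Let $T$ be a complete first-order theory in a language $L$, and let $\mathfrak{C}$ be a monster model of $T$: for some cardinal $\kappa > |L| + \aleph_0$, $\mathfrak{C}$ is $\kappa$-saturated and strongly $\kappa$-homogeneous (every partial elementary map of $\mathfrak{C}$ whose domain has fewer than $\kappa$ elements extends to an automorphism of $\mathfrak{C}$). Call a set *small* if it has cardinality less than $\kappa$. All tuples of elements are finite. A formula $\phi(\bar x, \bar a)$ *divides* over $A \subseteq \mathfrak{C}$ if there are $k < \omega$ and a sequence $(\bar a_i)_{i < \omega}$ of realizations of $\mathrm{tp}(\bar a / A)$ such that $\{\phi(\bar x, \bar a_i) : i < \omega\}$ is $k$-inconsistent. A complete type *forks* over $A$ if it implies a finite disjunction of formulas (with parameters from $\mathfrak{C}$), each of which divides over $A$. Forking has *dual finite character* (DFC) if for every small set $A$ and all tuples $\bar b, \bar c$ such that $\mathrm{tp}(\bar c / A \bar b)$ forks over $A$, there is a formula $\phi(\bar x, \bar y)$ over $A$ such that $\models \phi[\bar c, \bar b]$ and, for all $\bar b'$, $\models \phi[\bar c, \bar b']$ implies that $\mathrm{tp}(\bar c / A \bar b')$ forks over $A$. **Theorem.**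 Assume forking has DFC. Let $A \subseteq B$ be small sets, let $p \in S(B)$ be a complete type in finitely many variables that does not fork over $A$, and let $I$ be a small linearly ordered set. Then there is a Morley sequence $\langle \bar b_i \mid i \in I \rangle$ for $p$ over $A$; that is, each $\bar b_i$ realizes $p$, $\mathrm{tp}(\bar b_i / B \bar b_{<i})$ does not fork over $A$ for every $i \in I$ (where $\bar b_{<i} = (\bar b_j)_{j < i}$), and $\langle \bar b_i \mid i \in I \rangle$ is indiscernible over $B$. -/

import Mathlib

open FirstOrder Cardinal

universe u v w

namespace Forking

variable (L : FirstOrder.Language.{u, v}) {M : Type w} [L.Structure M] [Nonempty M]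

/-- `S_n(C)`: the complete `n`-types over the parameter set `C ⊆ M`, i.e. the complete types of the
theory of `M` with the elements of `C` named by constants. -/
abbrev TypesOver (C : Set M) (n : ℕ) : Type _ :=
  (L[[C]].completeTheory M).CompleteType (Fin n)

/-- `tp(v / C)`, the type of a finite tuple `v` of `M` over the parameter set `C`. -/
noncomputable def tp (C : Set M) {n : ℕ} (v : Fin n → M) : TypesOver L C n :=
  (L[[C]].completeTheory M).typeOf v

variable (M) in
/-- `M` is `κ`-saturated: every complete type in finitely many variables over a set of fewer than
`κ` parameters is realized in `M`. -/
def IsSaturated (κ : Cardinal.{w}) : Prop :=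
  ∀ C : Set M, #C < κ → ∀ (n : ℕ) (p : TypesOver L C n), ∃ v : Fin n → M, tp L C v = p

variable (M) in
/-- `M` is strongly `κ`-homogeneous: every partial elementary map of `M` whose domain has fewer than
`κ` elements extends to an automorphism of `M`. -/
def IsStronglyHomogeneous (κ : Cardinal.{w}) : Prop :=
  ∀ C : Set M, #C < κ → ∀ f : C → M,
    (∀ φ : L.Formula C, φ.Realize (fun c : C => (c : M)) ↔ φ.Realize f) →
      ∃ σ : M ≃[L] M, ∀ c : C, σ c = f c

variable {L} in
/-- `M` is a monster model of `T` (with respect to the cardinal `κ`): it is a model of `T` that is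
`κ`-saturated and strongly `κ`-homogeneous, where `κ > |L| + ℵ₀`. A set is *small* if its
cardinality is less than `κ`. -/
structure IsMonster (T : L.Theory) (M : Type w) [L.Structure M] [Nonempty M]
    (κ : Cardinal.{w}) : Prop where
  model : M ⊨ T
  aleph0_lt : ℵ₀ < κ
  card_lt : Cardinal.lift.{w} L.card < Cardinal.lift.{max u v} κ
  saturated : IsSaturated L M κ
  homogeneous : IsStronglyHomogeneous L M κ

variable {L}

/-- The formula `φ(x, a)` (with `x` an `n`-tuple of variables and `a` an `m`-tuple of parameters)
divides over `A`: there are `k < ω` and a sequence `(a_i)_{i < ω}` of realizations of `tp(a / A)`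
such that `{φ(x, a_i) : i < ω}` is `k`-inconsistent. -/
def Divides (A : Set M) {n m : ℕ} (φ : L.Formula (Fin n ⊕ Fin m)) (a : Fin m → M) : Prop :=
  ∃ (k : ℕ) (s : ℕ → Fin m → M), (∀ i, tp L A (s i) = tp L A a) ∧
    ∀ t : Finset ℕ, t.card = k → ¬ ∃ d : Fin n → M, ∀ i ∈ t, φ.Realize (Sum.elim d (s i))

/-- The complete type `p` over `C` forks over `A`: it implies a finite disjunction
`⋁_{l < r} φ_l(x, a_l)` of formulas, with parameters `a_l` from `M`, each dividing over `A`. -/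
def Forks {C : Set M} {n : ℕ} (p : TypesOver L C n) (A : Set M) : Prop :=
  ∃ (r : ℕ) (m : Fin r → ℕ) (φ : ∀ l, L.Formula (Fin n ⊕ Fin (m l))) (a : ∀ l, Fin (m l) → M),
    (∀ l, Divides A (φ l) (a l)) ∧
    ∃ Γ : Finset (L[[C]].Formula (Fin n)), (∀ ψ ∈ Γ, Language.Formula.equivSentence ψ ∈ p) ∧
      ∀ d : Fin n → M, (∀ ψ ∈ Γ, ψ.Realize d) → ∃ l, (φ l).Realize (Sum.elim d (a l))

variable (L M) in
/-- Forking has dual finite character (in the monster model `M`, over small sets): whenever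
`tp(c / A b)` forks over `A`, there is a formula `φ(x, y)` over `A` with `⊨ φ[c, b]` such that
`⊨ φ[c, b']` implies that `tp(c / A b')` forks over `A`. -/
def DualFiniteCharacter (κ : Cardinal.{w}) : Prop :=
  ∀ A : Set M, #A < κ → ∀ (n m : ℕ) (c : Fin n → M) (b : Fin m → M),
    Forks (tp L (A ∪ Set.range b) c) A →
      ∃ φ : L[[A]].Formula (Fin n ⊕ Fin m), φ.Realize (Sum.elim c b) ∧
        ∀ b' : Fin m → M, φ.Realize (Sum.elim c b') → Forks (tp L (A ∪ Set.range b') c) A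

/-- `(a_i)_{i ∈ I}` is an independent sequence for `p ∈ S_n(B)` over `A`: every `a_i` realizes `p`,
and `tp(a_i / B a_{<i})` does not fork over `A`. -/
structure IsIndependentSequence {I : Type*} [LinearOrder I] {n : ℕ} (a : I → Fin n → M)
    (A : Set M) {B : Set M} (p : TypesOver L B n) : Prop where
  realizes : ∀ i, tp L B (a i) = p
  not_forks : ∀ i, ¬ Forks (tp L (B ∪ ⋃ j : Set.Iio i, Set.range (a j)) (a i)) A

variable (L) in
/-- `(a_i)_{i ∈ I}` is indiscernible over `B`: any two finite increasing subsequences of the same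
length satisfy the same formulas over `B`. -/
def IsIndiscernible {I : Type*} [LinearOrder I] {n : ℕ} (a : I → Fin n → M) (B : Set M) : Prop :=
  ∀ (k : ℕ) (i j : Fin k → I), StrictMono i → StrictMono j →
    ∀ φ : L[[B]].Formula (Fin k × Fin n),
      φ.Realize (fun x => a (i x.1) x.2) ↔ φ.Realize (fun x => a (j x.1) x.2)

/-- A Morley sequence for `p ∈ S_n(B)` over `A`: an independent sequence for `p` over `A` that is
indiscernible over `B`. -/
structure IsMorleySequence {I : Type*} [LinearOrder I] {n : ℕ} (a : I → Fin n → M)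
    (A : Set M) {B : Set M} (p : TypesOver L B n) : Prop where
  independent : IsIndependentSequence a A p
  indiscernible : IsIndiscernible L a B

end Forking

/-!
Let `v` realize `p`. As `p` does not fork over `A`, the sets definable over `B` that contain `v`,
together with the complements of the sets dividing over `A`, have the finite intersection property,
so they lie in an ultrafilter `U` on `n`-tuples (`exists_ultrafilter_of_not_forks`). Realizing the
average type of `U` again and again gives `a 0, a 1, …`, an independent sequence for `p` over `A`
(`IsSaturated.exists_nat_sequence`, `not_forks_of_ultrafilter`).

To make it indiscernible and indexed by `I`, iterating an ultrafilter replaces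
the theorems of Ramsey and of Erdős and Rado. Fix a nonprincipal ultrafilter on `ℕ`; choosing indices generically one after the other
gives an ultrafilter `F` on `I → ℕ` whose members are increasing on any given finite set, almost
surely, and for which all increasing tuples of indices of a given length have the same distribution
(`exists_indiscernible_ultrafilter`). Let `b : I → Fin n → M` realize over `B` the average type of
`g ↦ (a (g i))_{i ∈ I}` along `F` (`IsSaturated.exists_realization`). Then `b` is indiscernible over
`B`, its members realize `p`, and every formula over `B` that holds of some members of `b` holds of
members of `a` standing in the same order.

Dual finite character makes independence pass from `a` to `b`
(`DualFiniteCharacter.not_forks_of_model`). If `tp(b i / B b_{<i})` forks over `A`, then so does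
`tp(b i / A e)` for a finite tuple `e` from `B b_{<i}`. Dual finite character gives a formula over
`A` that holds of `(b i, e)` and forces forking for all `e'` it relates to `b i`; since
automorphisms over `A` preserve it, it also forces forking for every realization of `tp(b i / A)` in place of
`b i` (`DualFiniteCharacter.exists_uniform_witness`). It holds of some `a k` and a tuple from
`B a_{<k}`, against the independence of `a`.

Types are handled through definable sets and ultrafilters throughout: two tuples have the same type
over `C` if they lie in the same `C`-definable sets (`tp_eq_tp_iff`), and forking of a type means
that one of its definable sets is covered by finitely many dividing ones (`forks_tp_iff`).
-/

namespace Forking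

open Filter Set

/-! ### Generic choice of indices -/

section Stretching

/-- The ultrafilter on `I → ℕ` that chooses the values along the list `l = [i₀, i₁, …]` one after
the other, generically for a fixed nonprincipal ultrafilter `𝒲` on `ℕ`, the later ones after the
earlier ones: a property `P x` is large if for `𝒲`-almost all `k₀`, for `𝒲`-almost all `k₁`, …, it
holds of the function `x` with `x i₀ = k₀`, `x i₁ = k₁`, …  Values off the list are `0`. -/
noncomputable def genericValues {I : Type*} [DecidableEq I] : List I → Ultrafilter (I → ℕ)
  | [] => pure fun _ => 0
  | i :: l => (hyperfilter ℕ).bind fun k =>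
      (genericValues l).map fun x => Function.update x i k

variable {I : Type*}

section DecidableEq

variable [DecidableEq I]

theorem eventually_genericValues_cons (i : I) (l : List I) (P : (I → ℕ) → Prop) :
    (∀ᶠ x in (genericValues (i :: l) : Filter (I → ℕ)), P x) ↔
      ∀ᶠ k in (hyperfilter ℕ : Filter ℕ), ∀ᶠ x in (genericValues l : Filter (I → ℕ)),
        P (Function.update x i k) :=
  Iff.rfl

/-- A property that only depends on the values along a sublist does not notice the remaining
generic choices. -/
theorem eventually_genericValues_of_sublist {l l' : List I} (hl : l.Sublist l') (hl' : l'.Nodup)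
    (P : (I → ℕ) → Prop) (hP : DependsOn P {i | i ∈ l}) :
    (∀ᶠ x in (genericValues l' : Filter (I → ℕ)), P x) ↔
      ∀ᶠ x in (genericValues l : Filter (I → ℕ)), P x := by
  induction hl generalizing P with
  | slnil => rfl
  | @cons l₁ l₂ i hs ih =>
    rw [eventually_genericValues_cons]
    have hi : i ∉ l₁ := fun h => (List.nodup_cons.1 hl').1 (hs.subset h)
    have h : ∀ (k : ℕ) x, P (Function.update x i k) = P x := fun k x => hP fun j hj =>
      Function.update_of_ne (ne_of_mem_of_not_mem hj hi) _ _
    simp only [h, eventually_const, ih (List.nodup_cons.1 hl').2 P hP]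
  | @cons_cons l₁ l₂ i hs ih =>
    simp only [eventually_genericValues_cons]
    refine eventually_congr (Eventually.of_forall fun k => ?_)
    refine ih (List.nodup_cons.1 hl').2 _ fun x y hxy => hP fun j hj => ?_
    by_cases hji : j = i
    · subst hji; simp
    · rw [Function.update_of_ne hji, Function.update_of_ne hji]
      exact hxy j ((List.mem_cons.1 hj).resolve_left hji)

/-- The distribution of the values along a list without repetitions only depends on the length of
the list. -/
theorem eventually_genericValues_ofFn {k : ℕ} (i j : Fin k → I) (hi : i.Injective)
    (hj : j.Injective) (P : (Fin k → ℕ) → Prop) :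
    (∀ᶠ x in (genericValues (List.ofFn i) : Filter (I → ℕ)), P (x ∘ i)) ↔
      ∀ᶠ x in (genericValues (List.ofFn j) : Filter (I → ℕ)), P (x ∘ j) := by
  induction k with
  | zero => simp only [List.ofFn_zero, Subsingleton.elim i j]
  | succ k ih =>
    have key : ∀ (e : Fin (k + 1) → I), e.Injective → ∀ (x : I → ℕ) (m : ℕ),
        Function.update x (e 0) m ∘ e = Fin.cons m (x ∘ fun t => e t.succ) := by
      intro e he x m
      funext t
      refine Fin.cases (by simp) (fun t => ?_) t
      simp [Function.update_of_ne (he.ne (Fin.succ_ne_zero t))]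
    simp only [List.ofFn_succ, eventually_genericValues_cons, key i hi, key j hj]
    refine eventually_congr (Eventually.of_forall fun m => ?_)
    exact ih _ _ (hi.comp (Fin.succ_injective k)) (hj.comp (Fin.succ_injective k))
      fun t => P (Fin.cons m t)

end DecidableEq

variable (I) in
/-- The combinatorial substitute for Ramsey's theorem: an ultrafilter on the maps `I → ℕ` that
concentrates on maps which are strictly increasing on any given finite set, and which does not
distinguish increasing tuples of indices of the same length. -/
theorem exists_indiscernible_ultrafilter [LinearOrder I] :
    ∃ F : Ultrafilter (I → ℕ), (∀ i j : I, i < j → ∀ᶠ g in (F : Filter (I → ℕ)), g i < g j) ∧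
      ∀ (k : ℕ) (i j : Fin k → I), StrictMono i → StrictMono j → ∀ P : (Fin k → ℕ) → Prop,
        (∀ᶠ g in (F : Filter (I → ℕ)), P (g ∘ i)) ↔
          ∀ᶠ g in (F : Filter (I → ℕ)), P (g ∘ j) := by
  classical
  let V : Ultrafilter (Finset I) := Ultrafilter.of atTop
  let F : Ultrafilter (I → ℕ) := V.bind fun s => genericValues (s.sort (· ≤ ·))
  have hF : ∀ l : List I, l.Pairwise (· < ·) → ∀ P : (I → ℕ) → Prop, DependsOn P {i | i ∈ l} →
      ((∀ᶠ g in (F : Filter (I → ℕ)), P g) ↔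
        ∀ᶠ g in (genericValues l : Filter (I → ℕ)), P g) := by
    intro l hl P hP
    have h : ∀ᶠ s in (V : Filter (Finset I)),
        ((∀ᶠ g in (genericValues (s.sort (· ≤ ·)) : Filter (I → ℕ)), P g) ↔
          ∀ᶠ g in (genericValues l : Filter (I → ℕ)), P g) := by
      refine (Ultrafilter.of_le atTop) ((eventually_ge_atTop l.toFinset).mono fun s hs => ?_)
      have hnd : l.Nodup := hl.imp fun h => h.ne
      refine eventually_genericValues_of_sublist ?_ (s.sort_nodup _) P hP
      refine List.sublist_of_subperm_of_pairwise (r := (· ≤ ·)) (List.subperm_of_subset hnd ?_)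
        (hl.imp fun h => h.le) (s.pairwise_sort (· ≤ ·))
      intro i hi
      exact (Finset.mem_sort _).2 (hs (List.mem_toFinset.2 hi))
    change (∀ᶠ s in (V : Filter (Finset I)),
      ∀ᶠ g in (genericValues (s.sort (· ≤ ·)) : Filter (I → ℕ)), P g) ↔ _
    rw [eventually_congr h, eventually_const]
  refine ⟨F, fun i j hij => ?_, fun k i j hi hj P => ?_⟩
  · rw [hF [i, j] (by simpa using hij) (fun g => g i < g j)
      fun x y h => by simp only [h i (by simp), h j (by simp)] ]
    simp only [eventually_genericValues_cons, Function.update_self,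
      Function.update_of_ne hij.ne']
    refine Eventually.of_forall fun k => ?_
    have : ∀ᶠ m in (hyperfilter ℕ : Filter ℕ), k < m :=
      (Nat.cofinite_eq_atTop ▸ hyperfilter_le_cofinite) (eventually_gt_atTop k)
    exact this.mono fun m hm => Eventually.of_forall fun _ => hm
  · have h : ∀ e : Fin k → I, StrictMono e → ((∀ᶠ g in (F : Filter (I → ℕ)), P (g ∘ e)) ↔
        ∀ᶠ g in (genericValues (List.ofFn e) : Filter (I → ℕ)), P (g ∘ e)) := by
      intro e he
      refine hF _ (List.pairwise_ofFn.2 fun a b hab => he hab) (fun g => P (g ∘ e))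
        fun x y hxy => ?_
      have : x ∘ e = y ∘ e := funext fun t => hxy _ (by simp)
      simp only [this]
    rw [h i hi, h j hj]
    exact eventually_genericValues_ofFn i j hi.injective hj.injective P

end Stretching

/-! ### Choice along a well-order -/

/-- Simultaneous choice along a well-order: if each requirement `R i c v` on the value `v` at `i`
only depends on the values of `c` below `i`, and can be met whenever the earlier requirements are
met, then some function meets all of them. -/
theorem exists_forall_of_wellFounded {J X : Type*} [Nonempty X] [Preorder J] [WellFoundedLT J]
    (R : J → (J → X) → X → Prop)
    (hdep : ∀ i c c' v, (∀ j < i, c j = c' j) → R i c v → R i c' v)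
    (hex : ∀ i c, (∀ j < i, R j c (c j)) → ∃ v, R i c v) :
    ∃ c : J → X, ∀ i, R i c (c i) := by
  classical
  let ext (i : J) (f : ∀ j, j < i → X) : J → X :=
    fun j => if h : j < i then f j h else Classical.arbitrary X
  let step (i : J) (f : ∀ j, j < i → X) : X := Classical.epsilon (R i (ext i f))
  let c : J → X := (wellFounded_lt (α := J)).fix step
  have hc : ∀ i, c i = Classical.epsilon (R i (ext i fun j _ => c j)) :=
    fun i => (wellFounded_lt (α := J)).fix_eq step i
  have hext : ∀ i, ∀ j < i, ext i (fun j _ => c j) j = c j := fun i j hj => dif_pos hj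
  refine ⟨c, fun i => ?_⟩
  induction i using WellFoundedLT.induction with
  | ind i ih =>
    refine hdep i _ c _ (hext i) ?_
    obtain ⟨v, hv⟩ := hex i c ih
    rw [hc i]
    exact Classical.epsilon_spec ⟨v, hdep i c _ v (fun j hj => (hext i j hj).symm) hv⟩

/-! ### Definable sets, types and saturation -/

section Definable

variable {L : FirstOrder.Language.{u, v}} {M : Type w} [L.Structure M]

/-- Substituting variables, and parameters from `B`, for the variables of a set definable over `A`
yields a set definable over `B`. -/
theorem definable_substitution {A B : Set M} (hAB : A ⊆ B) {α β : Type*} {S : Set (α → M)}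
    (hS : A.Definable L S) (h : α → B ⊕ β) :
    B.Definable L {v : β → M | (fun x => Sum.elim (fun b : B => (b : M)) v (h x)) ∈ S} := by
  obtain ⟨φ, rfl⟩ := definable_iff_exists_formula_sum.1 (hS.mono hAB)
  refine definable_iff_exists_formula_sum.2 ⟨φ.relabel (Sum.elim Sum.inl h), ?_⟩
  ext v
  simp only [mem_ofPred_eq, Language.Formula.realize_relabel]
  refine iff_of_eq (congrArg _ (funext fun x => ?_))
  cases x <;> rfl

/-- The image of a definable set under an automorphism is definable over the image of the
parameters. -/
theorem definable_image_automorphism (σ : M ≃[L] M) {A : Set M} {α : Type*}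
    {S : Set (α → M)} (hS : A.Definable L S) :
    (σ '' A).Definable L {v : α → M | (σ.symm ∘ v) ∈ S} := by
  obtain ⟨φ, rfl⟩ := definable_iff_exists_formula_sum.1 hS
  refine definable_iff_exists_formula_sum.2
    ⟨φ.relabel (Sum.map (fun a : A => (⟨σ a, a, a.2, rfl⟩ : σ '' A)) id), ?_⟩
  ext v
  simp only [mem_ofPred_eq, Language.Formula.realize_relabel]
  rw [← Language.StrongHomClass.realize_formula σ]
  refine iff_of_eq (congrArg _ (funext fun x => ?_))
  cases x <;> simp

theorem comp_automorphism_mem_iff (σ : M ≃[L] M) {A : Set M} (hσ : ∀ a ∈ A, σ a = a) {α : Type*}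
    {S : Set (α → M)} (hS : A.Definable L S) {v : α → M} : σ ∘ v ∈ S ↔ v ∈ S := by
  obtain ⟨φ, rfl⟩ := definable_iff_exists_formula_sum.1 hS
  simp only [mem_ofPred_eq]
  rw [← Language.StrongHomClass.realize_formula σ (v := Sum.elim _ v)]
  refine iff_of_eq (congrArg _ (funext fun x => ?_))
  rcases x with a | i
  · exact (hσ a a.2).symm
  · rfl

theorem definable_sInter {A : Set M} {α : Type*} {T : Set (Set (α → M))} (hT : T.Finite)
    (h : ∀ S ∈ T, A.Definable L S) : A.Definable L (⋂₀ T) := by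
  have := hT.to_subtype
  rw [sInter_eq_iInter]
  exact definable_iInter_of_finite fun S => h S S.2

theorem definable_setOf_realize {A : Set M} {α : Type*} (φ : L[[A]].Formula α) :
    A.Definable L {v | φ.Realize v} := ⟨φ, rfl⟩

variable [Nonempty M]

theorem tp_eq_tp_iff {C : Set M} {n : ℕ} {c d : Fin n → M} :
    tp L C c = tp L C d ↔ ∀ S : Set (Fin n → M), C.Definable L S → c ∈ S → d ∈ S := by
  have key : ∀ (φ : L[[C]].Formula (Fin n)) (e : Fin n → M),
      Language.Formula.equivSentence φ ∈ tp L C e ↔ φ.Realize e := fun φ e =>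
    Language.Theory.CompleteType.formula_mem_typeOf
  constructor
  · rintro h S ⟨φ, rfl⟩ hc
    exact (key φ d).1 (h ▸ (key φ c).2 hc)
  · intro h
    refine SetLike.ext fun θ => ?_
    obtain ⟨φ, rfl⟩ := Language.Formula.equivSentence.surjective θ
    rw [key, key]
    refine ⟨h _ ⟨φ, rfl⟩, fun hd => ?_⟩
    by_contra hc
    exact h _ (definable_setOf_realize φ).compl hc hd

theorem tp_eq_tp_mono {A B : Set M} (hAB : A ⊆ B) {n : ℕ} {c d : Fin n → M}
    (h : tp L B c = tp L B d) : tp L A c = tp L A d :=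
  tp_eq_tp_iff.2 fun S hS => tp_eq_tp_iff.1 h S (hS.mono hAB)

/-- Saturation in terms of ultrafilters: over a small set, the average type of an ultrafilter on
finite tuples is realized. -/
theorem IsSaturated.exists_mem_of_ultrafilter {κ : Cardinal.{w}} (hM : IsSaturated L M κ)
    {C : Set M} (hC : #C < κ) {n : ℕ} (U : Ultrafilter (Fin n → M)) :
    ∃ c : Fin n → M, ∀ S : Set (Fin n → M), C.Definable L S → S ∈ U → c ∈ S := by
  let Θ : Set (L[[C]][[Fin n]].Sentence) :=
    {θ | ∀ᶠ x in (U : Filter (Fin n → M)), (Language.Formula.equivSentence.symm θ).Realize x}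
  have hmax : Language.Theory.IsMaximal Θ := by
    refine ⟨Language.Theory.isSatisfiable_iff_isFinitelySatisfiable.2 fun T₀ hT₀ => ?_, fun θ => ?_⟩
    · have h : ∀ᶠ x in (U : Filter (Fin n → M)), ∀ θ ∈ T₀,
          (Language.Formula.equivSentence.symm θ).Realize x :=
        (eventually_all_finset T₀).2 fun θ hθ => hT₀ hθ
      obtain ⟨x, hx⟩ := h.exists
      let _ : (Language.constantsOn (Fin n)).Structure M := Language.constantsOn.structure x
      have : M ⊨ (T₀ : Language.Theory (L[[C]][[Fin n]])) := by
        refine ⟨fun θ hθ => ?_⟩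
        exact (Language.Formula.realize_equivSentence_symm M θ x).1 (hx θ hθ)
      exact Language.Theory.Model.isSatisfiable M
    · simp only [Θ, mem_ofPred_eq]
      refine (Ultrafilter.em U _).imp_right fun h => h.mono fun x hx => ?_
      rw [Language.Formula.realize_equivSentence_symm] at hx ⊢
      exact hx
  let q : TypesOver L C n := ⟨Θ, fun θ hθ => ?_, hmax⟩
  · obtain ⟨c, hc⟩ := hM C hC n q
    refine ⟨c, ?_⟩
    rintro S ⟨φ, rfl⟩ hφ
    have hmem : Language.Formula.equivSentence φ ∈ tp L C c := by
      rw [hc]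
      change ∀ᶠ x in (U : Filter (Fin n → M)), (Language.Formula.equivSentence.symm
        (Language.Formula.equivSentence φ)).Realize x
      rw [Equiv.symm_apply_apply]
      exact hφ
    exact Language.Theory.CompleteType.formula_mem_typeOf.1 hmem
  · refine Eventually.of_forall fun x => ?_
    rw [Language.Formula.realize_equivSentence_symm]
    exact (Language.Theory.CompleteType.mem_typeOf.1 ((tp L C x).subset hθ)) |>
      (Language.Formula.realize_equivSentence_symm _ _ _).1

end Definable

/-! ### Realizing types in a small number of variables -/

section Realization

variable {L : FirstOrder.Language.{u, v}} {M : Type w} [L.Structure M]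

variable (L) in
/-- The point `c` satisfies the average of the ultrafilter `F` on `J → M` as far as it concerns the
coordinates in `K`: it lies in every set of `F` that is definable over `B` and depends on finitely
many coordinates only, all of them in `K`. -/
def RealizesOn {J : Type*} (F : Ultrafilter (J → M)) (B : Set M) (c : J → M) (K : Set J) : Prop :=
  ∀ S : Set (J → M), B.Definable L S → ∀ V : Set J, V.Finite → V ⊆ K → DependsOn (· ∈ S) V →
    S ∈ F → c ∈ S

variable {J : Type*} {F : Ultrafilter (J → M)} {B : Set M} {c c' : J → M} {K : Set J}

theorem RealizesOn.congr (h : RealizesOn L F B c K) (hc : ∀ j ∈ K, c j = c' j) :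
    RealizesOn L F B c' K := fun S hS V hV hVK hdep hSF =>
  (hdep fun j hj => hc j (hVK hj)).mp (h S hS V hV hVK hdep hSF)

theorem realizesOn_of_Iic [LinearOrder J] (h : ∀ j ∈ K, RealizesOn L F B c (Iic j)) :
    RealizesOn L F B c K := by
  intro S hS V hV hVK hdep hSF
  rcases V.eq_empty_or_nonempty with rfl | hne
  · obtain ⟨x, hx⟩ := F.nonempty_of_mem hSF
    exact (hdep.empty x c).mp hx
  · obtain ⟨j, hj, hmax⟩ := hV.exists_maximal hne
    exact h j (hVK hj) S hS V hV (fun t ht => (le_total t j).elim id (hmax ht)) hdep hSF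

variable [Nonempty M]

/-- One more coordinate can be realized: the conditions on it are consistent since projections of
definable sets are definable, and they involve few parameters. -/
theorem RealizesOn.exists_update [DecidableEq J] {κ : Cardinal.{w}} (hM : IsSaturated L M κ)
    (hB : #(B ∪ range c : Set M) < κ) (h : RealizesOn L F B c K) (i : J) :
    ∃ v, RealizesOn L F B (Function.update c i v) (insert i K) := by
  let P : Set (J → M) → Prop := fun S =>
    B.Definable L S ∧ (∃ V : Set J, V.Finite ∧ V ⊆ insert i K ∧ DependsOn (· ∈ S) V) ∧ S ∈ F
  let fib : Set (J → M) → Set (Fin 1 → M) := fun S => {v | Function.update c i (v 0) ∈ S}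
  have hinter : ∀ T : Set (Set (J → M)), T.Finite → (∀ S ∈ T, P S) → P (⋂₀ T) := by
    intro T hT
    induction T, hT using Set.Finite.induction_on with
    | empty =>
      intro _
      refine ⟨by simp, ⟨∅, finite_empty, empty_subset _, by simp [DependsOn]⟩, ?_⟩
      rw [sInter_empty]
      exact univ_mem
    | @insert S T _ _ ih =>
      intro hP
      obtain ⟨hd, ⟨V, hV, hVK, hdep⟩, hF⟩ := hP S (mem_insert _ _)
      obtain ⟨hd', ⟨V', hV', hVK', hdep'⟩, hF'⟩ := ih fun S hS => hP S (mem_insert_of_mem _ hS)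
      rw [sInter_insert]
      refine ⟨hd.inter hd', ⟨V ∪ V', hV.union hV', union_subset hVK hVK', fun x y hxy => ?_⟩,
        inter_mem hF hF'⟩
      have h₁ := hdep fun j hj => hxy j (Or.inl hj)
      have h₂ := hdep' fun j hj => hxy j (Or.inr hj)
      simp only [mem_inter_iff]
      exact congrArg₂ And h₁ h₂
  have hne : ∀ S, P S → (fib S).Nonempty := by
    rintro S ⟨hd, ⟨V, hV, hVK, hdep⟩, hF⟩
    let S' : Set (J → M) := {x | ∃ v : M, Function.update x i v ∈ S}
    have hS' : B.Definable L S' := by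
      have h₁ := (hd.preimage_comp (β := J ⊕ Fin 1)
        fun j => if j = i then Sum.inr 0 else Sum.inl j).exists_of_finite
      convert h₁ using 1
      ext x
      have h₂ : ∀ u : Fin 1 → M, (Sum.elim x u ∘ fun j => if j = i then Sum.inr 0 else Sum.inl j) =
          Function.update x i (u 0) := by
        intro u
        funext j
        by_cases hj : j = i
        · subst hj; simp
        · simp [hj]
      simp only [S', mem_ofPred_eq, mem_preimage, h₂]
      exact ⟨fun ⟨v, hv⟩ => ⟨fun _ => v, hv⟩, fun ⟨u, hu⟩ => ⟨u 0, hu⟩⟩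
    have hdep' : DependsOn (· ∈ S') (V \ {i}) := by
      intro x y hxy
      refine propext (exists_congr fun v => iff_of_eq (hdep fun j hj => ?_))
      by_cases hji : j = i
      · subst hji; simp
      · simp only [Function.update_of_ne hji]
        exact hxy j ⟨hj, hji⟩
    obtain ⟨v, hv⟩ := h S' hS' (V \ {i}) hV.sdiff
      (fun j hj => (hVK hj.1).resolve_left hj.2) hdep'
      (mem_of_superset hF fun x hx => ⟨x i, by simpa using hx⟩)
    exact ⟨fun _ => v, hv⟩
  obtain ⟨U, hU⟩ := Ultrafilter.exists_ultrafilter_of_finite_inter_nonempty (fib '' {S | P S}) (by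
    intro T hT
    obtain ⟨T', hT'P, hT'fin, hT'⟩ :=
      exists_subset_image_finite_and (p := (· = (T : Set (Set (Fin 1 → M))))).1
        ⟨_, hT, T.finite_toSet, rfl⟩
    obtain ⟨v, hv⟩ := hne _ (hinter T' hT'fin hT'P)
    rw [← hT']
    refine ⟨v, ?_⟩
    rintro _ ⟨S, hS, rfl⟩
    exact hv S hS)
  obtain ⟨v, hv⟩ := hM.exists_mem_of_ultrafilter hB U
  refine ⟨v 0, fun S hS V hV hVK hdep hSF => hv (fib S) ?_
    (hU ⟨S, ⟨hS, ⟨V, hV, hVK, hdep⟩, hSF⟩, rfl⟩)⟩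
  have h₁ := definable_substitution (subset_union_left (t := range c)) hS
    fun j => if j = i then Sum.inr (0 : Fin 1) else Sum.inl ⟨c j, Or.inr ⟨j, rfl⟩⟩
  convert h₁ using 1
  ext x
  simp only [fib, mem_ofPred_eq]
  refine iff_of_eq (congrArg (· ∈ S) (funext fun j => ?_))
  by_cases hj : j = i
  · subst hj; simp
  · simp [hj]

/-- A saturated structure realizes, over small sets, average types of ultrafilters in a small number
of variables. Membership is tested on sets given by a definable condition on finitely many
coordinates and parameters. -/
theorem IsSaturated.exists_realization {κ : Cardinal.{w}} (hM : IsSaturated L M κ) (hκ : ℵ₀ ≤ κ)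
    (hB : #B < κ) (hJ : Cardinal.lift.{w} #J < Cardinal.lift κ) (F : Ultrafilter (J → M)) :
    ∃ c : J → M, ∀ (α : Type) [Finite α] (h : α → B ⊕ J) (S : Set (α → M)), B.Definable L S →
      ((fun t => Sum.elim (fun b : B => (b : M)) c (h t)) ∈ S ↔
        ∀ᶠ x in (F : Filter (J → M)), (fun t => Sum.elim (fun b : B => (b : M)) x (h t)) ∈ S) := by
  classical
  obtain ⟨_, _⟩ := exists_wellFoundedLT J
  obtain ⟨c, hc⟩ : ∃ c : J → M, ∀ i, RealizesOn L F B (Function.update c i (c i)) (Iic i) := by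
    refine exists_forall_of_wellFounded
      (fun i c v => RealizesOn L F B (Function.update c i v) (Iic i)) ?_ ?_
    · intro i c c' v hcc h
      refine h.congr fun j hj => ?_
      rcases (mem_Iic.1 hj).eq_or_lt with rfl | hlt
      · simp
      · simp [hlt.ne, hcc j hlt]
    · intro i c h
      have hr : #(range c) < κ := by
        rw [← Cardinal.lift_lt]
        exact (mk_range_le_lift).trans_lt hJ
      have := RealizesOn.exists_update (F := F) (B := B) (c := c) (K := Iio i) hM
        ((mk_union_le _ _).trans_lt (add_lt_of_lt hκ hB hr))
        (realizesOn_of_Iic fun j hj => by simpa using h j hj) i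
      rwa [Iio_insert] at this
  have hc' : RealizesOn L F B c univ := realizesOn_of_Iic fun j _ => by simpa using hc j
  have key : ∀ (α : Type) [Finite α] (h : α → B ⊕ J) (S : Set (α → M)), B.Definable L S →
      (∀ᶠ x in (F : Filter (J → M)), (fun t => Sum.elim (fun b : B => (b : M)) x (h t)) ∈ S) →
      (fun t => Sum.elim (fun b : B => (b : M)) c (h t)) ∈ S := by
    intro α _ h S hS hF
    refine hc' _ (definable_substitution le_rfl hS h) (Sum.inr ⁻¹' range h)
      ((finite_range h).preimage Sum.inr_injective.injOn) (subset_univ _) (fun x y hxy => ?_) hF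
    have : (fun t => Sum.elim (fun b : B => (b : M)) x (h t)) =
        fun t => Sum.elim (fun b : B => (b : M)) y (h t) := by
      funext t
      rcases ht : h t with b | j
      · rfl
      · exact hxy j ⟨t, ht⟩
    simp only [mem_ofPred_eq, this]
  refine ⟨c, fun α _ h S hS => ⟨fun hmem => ?_, key α h S hS⟩⟩
  by_contra hF
  exact key α h Sᶜ hS.compl (Ultrafilter.eventually_not.2 hF) hmem

end Realization

/-! ### Forking -/

section Dividing

variable {L : FirstOrder.Language.{u, v}} {M : Type w} [L.Structure M] [Nonempty M]

variable (L) in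
/-- The sets of `n`-tuples defined by formulas that divide over `A`. -/
def dividingSets (A : Set M) (n : ℕ) : Set (Set (Fin n → M)) :=
  {X | ∃ (m : ℕ) (φ : L.Formula (Fin n ⊕ Fin m)) (a : Fin m → M), Divides A φ a ∧
    X = {d | φ.Realize (Sum.elim d a)}}

variable {A B C : Set M} {n : ℕ} {c : Fin n → M}

/-- The type of `c` over `C` forks over `A` if and only if some `C`-definable set containing `c` is
covered by finitely many sets that divide over `A`. -/
theorem forks_tp_iff : Forks (tp L C c) A ↔ ∃ S : Set (Fin n → M), C.Definable L S ∧ c ∈ S ∧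
    ∃ D ⊆ dividingSets L A n, D.Finite ∧ S ⊆ ⋃₀ D := by
  constructor
  · rintro ⟨r, m, φ, a, hdiv, Γ, hΓ, hcov⟩
    refine ⟨⋂ ψ ∈ Γ, {d | ψ.Realize d},
      definable_biInter_finset (fun ψ => definable_setOf_realize ψ) Γ, ?_,
      range fun l => {d | (φ l).Realize (Sum.elim d (a l))}, ?_, finite_range _, ?_⟩
    · simp only [mem_iInter]
      exact fun ψ hψ => Language.Theory.CompleteType.formula_mem_typeOf.1 (hΓ ψ hψ)
    · rintro _ ⟨l, rfl⟩
      exact ⟨m l, φ l, a l, hdiv l, rfl⟩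
    · intro d hd
      simp only [mem_iInter] at hd
      obtain ⟨l, hl⟩ := hcov d hd
      exact ⟨_, ⟨l, rfl⟩, hl⟩
  · rintro ⟨S, ⟨ψ, rfl⟩, hc, D, hD, hfin, hcov⟩
    obtain ⟨r, f, -, rfl⟩ := hfin.fin_param
    choose m φ a hdiv heq using fun l => hD (mem_range_self l)
    refine ⟨r, m, φ, a, hdiv, {ψ}, ?_, fun d hd => ?_⟩
    · intro ψ' hψ'
      rw [Finset.mem_singleton.1 hψ']
      exact Language.Theory.CompleteType.formula_mem_typeOf.2 hc
    · obtain ⟨_, ⟨l, rfl⟩, hl⟩ := hcov (hd ψ (Finset.mem_singleton_self ψ))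
      rw [heq l] at hl
      exact ⟨l, hl⟩

theorem Forks.mono (hBC : B ⊆ C) (h : Forks (tp L B c) A) : Forks (tp L C c) A := by
  obtain ⟨S, hS, h⟩ := forks_tp_iff.1 h
  exact forks_tp_iff.2 ⟨S, hS.mono hBC, h⟩

/-- Forking of a type over `C` is witnessed by a finite tuple of elements of `C`. -/
theorem Forks.exists_finite (h : Forks (tp L C c) A) :
    ∃ (m : ℕ) (e : Fin m → M), (∀ t, e t ∈ C) ∧ Forks (tp L (range e) c) A := by
  obtain ⟨S, hS, h⟩ := forks_tp_iff.1 h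
  obtain ⟨E, hEC, hSE⟩ := definable_iff_finitely_definable.1 hS
  obtain ⟨m, e, _, he⟩ := E.finite_toSet.fin_param
  refine ⟨m, e, fun t => hEC (he ▸ mem_range_self t), forks_tp_iff.2 ⟨S, he ▸ hSE, h⟩⟩

theorem tp_comp_automorphism (σ : M ≃[L] M) (hσ : ∀ a ∈ A, σ a = a) :
    tp L A (σ ∘ c) = tp L A c :=
  (tp_eq_tp_iff.2 fun _ hS hc => (comp_automorphism_mem_iff σ hσ hS).2 hc).symm

/-- Forking over `A` is invariant under automorphisms that fix `A` pointwise. -/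
theorem Forks.automorphism (σ : M ≃[L] M) (hσ : ∀ a ∈ A, σ a = a) (h : Forks (tp L C c) A) :
    Forks (tp L (σ '' C) (σ ∘ c)) A := by
  obtain ⟨S, hS, hc, D, hD, hfin, hcov⟩ := forks_tp_iff.1 h
  refine forks_tp_iff.2 ⟨_, definable_image_automorphism σ hS, ?_,
    (fun X => {d | σ.symm ∘ d ∈ X}) '' D, ?_, hfin.image _, ?_⟩
  · have : σ.symm ∘ σ ∘ c = c := by ext; simp
    rwa [mem_ofPred_eq, this]
  · rintro _ ⟨X, hX, rfl⟩
    obtain ⟨m, φ, a, ⟨k, s, hs, hk⟩, rfl⟩ := hD hX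
    refine ⟨m, φ, σ ∘ a, ⟨k, s, fun i => (hs i).trans (tp_comp_automorphism σ hσ).symm, hk⟩, ?_⟩
    ext d
    simp only [mem_ofPred_eq]
    rw [← Language.StrongHomClass.realize_formula σ]
    refine iff_of_eq (congrArg _ (funext fun x => ?_))
    cases x <;> simp
  · intro d hd
    obtain ⟨X, hX, hdX⟩ := hcov hd
    exact ⟨_, ⟨X, hX, rfl⟩, hdX⟩

/-- A nonforking type extends to a global nonforking type, given here as the average of an
ultrafilter. -/
theorem exists_ultrafilter_of_not_forks (h : ¬ Forks (tp L B c) A) :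
    ∃ U : Ultrafilter (Fin n → M), (∀ S, B.Definable L S → c ∈ S → S ∈ U) ∧
      ∀ X ∈ dividingSets L A n, X ∉ U := by
  let P : Set (Set (Fin n → M)) := {S | B.Definable L S ∧ c ∈ S}
  let Q : Set (Set (Fin n → M)) := {S | Sᶜ ∈ dividingSets L A n}
  obtain ⟨U, hU⟩ := Ultrafilter.exists_ultrafilter_of_finite_inter_nonempty (P ∪ Q) (by
    intro T hT
    by_contra hemp
    refine h (forks_tp_iff.2 ⟨⋂₀ (T ∩ P), ?_, fun S hS => hS.2.2, compl '' (T ∩ Q), ?_,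
      (T.finite_toSet.inter_of_left Q).image _, ?_⟩)
    · exact definable_sInter (T.finite_toSet.inter_of_left P) fun S hS => hS.2.1
    · rintro _ ⟨S, hS, rfl⟩
      exact hS.2
    · intro d hd
      by_contra hd'
      refine hemp ⟨d, fun S hS => ?_⟩
      rcases hT hS with hP | hQ
      · exact hd S ⟨hS, hP⟩
      · by_contra hdS
        exact hd' ⟨Sᶜ, ⟨S, ⟨hS, hQ⟩, rfl⟩, hdS⟩)
  refine ⟨U, fun S hS hc => hU (Or.inl ⟨hS, hc⟩), fun X hX hXU => ?_⟩
  have : Xᶜ ∈ U := hU (Or.inr (by simpa [Q] using hX))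
  exact Ultrafilter.compl_notMem_iff.2 hXU this

/-- A realization over `C` of the average type of an ultrafilter without dividing sets has a
nonforking type over `C`. -/
theorem not_forks_of_ultrafilter {U : Ultrafilter (Fin n → M)}
    (hU : ∀ X ∈ dividingSets L A n, X ∉ U)
    (hc : ∀ S : Set (Fin n → M), C.Definable L S → S ∈ U → c ∈ S) : ¬ Forks (tp L C c) A := by
  intro h
  obtain ⟨S, hS, hcS, D, hD, hfin, hcov⟩ := forks_tp_iff.1 h
  have hSU : S ∈ U := by
    by_contra hn
    exact hc Sᶜ hS.compl (Ultrafilter.compl_mem_iff_notMem.2 hn) hcS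
  obtain ⟨X, hX, hXU⟩ := (Ultrafilter.finite_sUnion_mem_iff hfin).1 (mem_of_superset hSU hcov)
  exact hU X (hD hX) hXU

/-- Strong homogeneity, for finite tuples: tuples with the same type over a small set are conjugate
over it. -/
theorem IsStronglyHomogeneous.exists_automorphism {κ : Cardinal.{w}}
    (hM : IsStronglyHomogeneous L M κ) (hκ : ℵ₀ ≤ κ) (hA : #A < κ) {d : Fin n → M}
    (h : tp L A c = tp L A d) :
    ∃ σ : M ≃[L] M, (∀ a ∈ A, σ a = a) ∧ σ ∘ c = d := by
  classical
  have hS := tp_eq_tp_iff.1 h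
  let C : Set M := A ∪ range c
  have hidx : ∀ x : C, x.1 ∉ A → ∃ t, c t = x.1 := fun x hx => x.2.resolve_left hx
  choose idx hidx using hidx
  let sub : C → A ⊕ Fin n := fun x => if hx : x.1 ∈ A then Sum.inl ⟨x, hx⟩ else Sum.inr (idx x hx)
  let f : (Fin n → M) → C → M := fun v x => Sum.elim (fun a : A => (a : M)) v (sub x)
  have hfA : ∀ v (x : C), x.1 ∈ A → f v x = x := fun v x hx => by simp [f, sub, hx]
  have hfc : f c = fun x : C => x.1 := by
    funext x
    by_cases hx : x.1 ∈ A
    · exact hfA c x hx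
    · simp [f, sub, hx, hidx]
  -- Elements of the tuple that lie in `A` or are repeated cause no conflict.
  have hfd : ∀ t, f d ⟨c t, Or.inr ⟨t, rfl⟩⟩ = d t := by
    intro t
    let x : C := ⟨c t, Or.inr ⟨t, rfl⟩⟩
    have hx : A.Definable L {v : Fin n → M | f v x = v t} := by
      have := definable_substitution (β := Fin n) (empty_subset A)
        ((empty_definable_iff (L := L) (M := M)).2
          ⟨(Language.Term.var (0 : Fin 2)).equal (Language.Term.var 1), rfl⟩) ![sub x, Sum.inr t]
      simpa [f] using this
    exact hS _ hx (congrFun hfc x)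
  have hcard : #C < κ := (mk_union_le _ _).trans_lt
    (add_lt_of_lt hκ hA (((finite_range c).lt_aleph0).trans_le hκ))
  obtain ⟨σ, hσ⟩ := hM C hcard (f d) fun φ => by
    have hdef : ∀ φ : L.Formula C, A.Definable L {v : Fin n → M | φ.Realize (f v)} := fun φ =>
      definable_substitution le_rfl
        ((empty_definable_iff.2 ⟨φ, rfl⟩).mono (empty_subset A)) sub
    rw [← hfc]
    refine ⟨fun hφ => hS _ (hdef φ) hφ, fun hφ => ?_⟩
    by_contra hn
    exact hS _ (hdef φ).compl hn hφ
  exact ⟨σ, fun a ha => (hσ ⟨a, Or.inl ha⟩).trans (hfA d _ ha),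
    funext fun t => (hσ ⟨c t, Or.inr ⟨t, rfl⟩⟩).trans (hfd t)⟩

/-- Dual finite character yields a definable witness of forking that works for all conjugates
of the tuple at once. -/
theorem DualFiniteCharacter.exists_uniform_witness {κ : Cardinal.{w}}
    (hDFC : DualFiniteCharacter L M κ) (hM : IsStronglyHomogeneous L M κ) (hκ : ℵ₀ ≤ κ)
    (hA : #A < κ) {m : ℕ} {e : Fin m → M} (h : Forks (tp L (A ∪ range e) c) A) :
    ∃ S : Set (Fin n ⊕ Fin m → M), A.Definable L S ∧ Sum.elim c e ∈ S ∧
      ∀ c', tp L A c' = tp L A c → ∀ e', Sum.elim c' e' ∈ S →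
        Forks (tp L (A ∪ range e') c') A := by
  obtain ⟨φ, hφ, hforks⟩ := hDFC A hA n m c e h
  refine ⟨_, definable_setOf_realize φ, hφ, fun c' hc' e' he' => ?_⟩
  obtain ⟨σ, hσA, rfl⟩ := hM.exists_automorphism hκ hA hc'.symm
  -- Pull `e'` back along `σ`, so that the first tuple becomes `c` itself.
  have hpull : φ.Realize (Sum.elim c (σ.symm ∘ e')) := by
    refine (comp_automorphism_mem_iff σ hσA (definable_setOf_realize φ)).1 ?_
    convert he' using 1
    ext x
    cases x <;> simp
  have := (hforks _ hpull).automorphism σ hσA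
  refine this.mono ?_
  rintro _ ⟨x, hx | ⟨t, rfl⟩, rfl⟩
  · exact Or.inl ((hσA x hx).symm ▸ hx)
  · exact Or.inr ⟨t, by simp⟩

end Dividing

/-! ### Morley sequences -/

variable {L : FirstOrder.Language.{u, v}} {M : Type w} [L.Structure M] [Nonempty M]

/-- Realizing the average type of an ultrafilter on `n`-tuples again and again, each time over `B`
and the preceding realizations. -/
theorem IsSaturated.exists_nat_sequence {κ : Cardinal.{w}} (hM : IsSaturated L M κ) (hκ : ℵ₀ < κ)
    {B : Set M} (hB : #B < κ) {n : ℕ} (U : Ultrafilter (Fin n → M)) :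
    ∃ a : ℕ → Fin n → M, ∀ (i : ℕ) (S : Set (Fin n → M)),
      (B ∪ ⋃ j : Iio i, range (a j)).Definable L S → S ∈ U → a i ∈ S := by
  refine exists_forall_of_wellFounded (fun (i : ℕ) (a : ℕ → Fin n → M) v =>
    ∀ S : Set (Fin n → M), (B ∪ ⋃ j : Iio i, range (a j)).Definable L S → S ∈ U → v ∈ S) ?_ ?_
  · intro i a a' v haa' h
    have : (⋃ j : Iio i, range (a j)) = ⋃ j : Iio i, range (a' j) :=
      iUnion_congr fun j => by rw [haa' j j.2]
    rwa [← this]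
  · intro i a _
    refine hM.exists_mem_of_ultrafilter ((mk_union_le _ _).trans_lt (add_lt_of_lt hκ.le hB ?_)) U
    have : (⋃ j : Iio i, range (a j)).Countable :=
      countable_iUnion fun j => countable_range (a j)
    exact this.le_aleph0.trans_lt hκ

/-- A sequence modelled on `a : ℕ → Fin n → M` through an ultrafilter of index maps that are
increasing on finite sets is independent whenever `a` is: by dual finite character, forking would
be witnessed by a formula, which would also hold of some of the tuples `a k`, in increasing
order. -/
theorem DualFiniteCharacter.not_forks_of_model {κ : Cardinal.{w}}
    (hDFC : DualFiniteCharacter L M κ) (hM : IsStronglyHomogeneous L M κ) (hκ : ℵ₀ ≤ κ)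
    {A B : Set M} (hAB : A ⊆ B) (hA : #A < κ) {n : ℕ} {a : ℕ → Fin n → M}
    (ha : ∀ k, ¬ Forks (tp L (B ∪ ⋃ j : Iio k, range (a j)) (a k)) A)
    {I : Type*} [LinearOrder I] {F : Ultrafilter (I → ℕ)}
    (hF : ∀ i j : I, i < j → ∀ᶠ g in (F : Filter (I → ℕ)), g i < g j)
    {b : I → Fin n → M} (htp : ∀ i k, tp L A (a k) = tp L A (b i))
    (hb : ∀ (α : Type) [Finite α] (h : α → B ⊕ (I × Fin n)) (S : Set (α → M)), B.Definable L S →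
      (fun t => Sum.elim (fun x : B => (x : M)) (fun x => b x.1 x.2) (h t)) ∈ S →
      ∀ᶠ g in (F : Filter (I → ℕ)),
        (fun t => Sum.elim (fun x : B => (x : M)) (fun x => a (g x.1) x.2) (h t)) ∈ S) (i : I) :
    ¬ Forks (tp L (B ∪ ⋃ j : Iio i, range (b j)) (b i)) A := by
  intro hfork
  obtain ⟨m, e, he, hfork⟩ := hfork.exists_finite
  obtain ⟨S, hS, hmem, huniform⟩ :=
    hDFC.exists_uniform_witness hM hκ hA (hfork.mono (subset_union_right (s := A)))
  -- Each entry of `e` is a parameter from `B` or an entry of an earlier tuple of the sequence.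
  have hsrc : ∀ t, ∃ y : B ⊕ (Iio i × Fin n),
      Sum.elim (fun x : B => (x : M)) (fun x => b x.1 x.2) y = e t := by
    intro t
    rcases he t with h | h
    · exact ⟨Sum.inl ⟨e t, h⟩, rfl⟩
    · obtain ⟨j, l, hl⟩ := mem_iUnion.1 h
      exact ⟨Sum.inr (j, l), hl⟩
  choose y hy using hsrc
  let incl : B ⊕ (Iio i × Fin n) → B ⊕ (I × Fin n) := Sum.map id fun x => (x.1.1, x.2)
  have hsmall : ∀ᶠ g in (F : Filter (I → ℕ)), ∀ t j l, y t = Sum.inr (j, l) → g j < g i := by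
    refine eventually_all.2 fun t => ?_
    rcases hyt : y t with x | ⟨j, l⟩
    · exact Eventually.of_forall fun g j l h => by cases h
    · refine (hF j i j.2).mono fun g hg j' l' h => ?_
      cases h
      exact hg
  have hlarge := hb (Fin n ⊕ Fin m) (Sum.elim (fun l => Sum.inr (i, l)) (incl ∘ y)) S
    (hS.mono hAB) (by
      convert hmem using 1
      ext t
      rcases t with l | t
      · rfl
      · refine Eq.trans ?_ (hy t)
        rw [Sum.elim_inr, Function.comp_apply]
        cases y t <;> rfl)
  obtain ⟨g, hg, hgS⟩ := (hsmall.and hlarge).exists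
  let e' : Fin m → M := fun t =>
    Sum.elim (fun x : B => (x : M)) (fun x => a (g x.1) x.2) (incl (y t))
  have hforks := huniform (a (g i)) (htp i (g i)) e' (by
    convert hgS using 1
    ext t
    cases t <;> rfl)
  refine ha (g i) (hforks.mono (union_subset (hAB.trans subset_union_left) ?_))
  rintro _ ⟨t, rfl⟩
  rcases hyt : y t with x | ⟨j, l⟩
  · exact Or.inl (by simp [e', incl, hyt])
  · exact Or.inr (mem_iUnion.2 ⟨⟨g j, hg t j l hyt⟩, l, by simp [e', incl, hyt]⟩)

end Forking

open Filter Set in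
theorem theorem5 {L : FirstOrder.Language.{u, v}} (T : L.Theory) (hT : T.IsComplete)
    {M : Type w} [L.Structure M] [Nonempty M] (κ : Cardinal.{w})
    (hM : Forking.IsMonster T M κ)
    (hDFC : Forking.DualFiniteCharacter L M κ)
    (A B : Set M) (hAB : A ⊆ B) (hB : #B < κ)
    (n : ℕ) (p : Forking.TypesOver L B n) (hp : ¬ Forking.Forks p A)
    (I : Type*) [LinearOrder I] (hI : Cardinal.lift.{w} #I < Cardinal.lift κ) :
    ∃ b : I → Fin n → M, Forking.IsMorleySequence b A p := by
  have hκ := hM.aleph0_lt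
  obtain ⟨v, rfl⟩ := hM.saturated B hB n p
  obtain ⟨U, hvU, hU⟩ := Forking.exists_ultrafilter_of_not_forks hp
  obtain ⟨a, ha⟩ := hM.saturated.exists_nat_sequence hκ hB U
  have hva : ∀ k S, B.Definable L S → v ∈ S → a k ∈ S := fun k S hS hv =>
    ha k S (hS.mono subset_union_left) (hvU S hS hv)
  have hIn : Cardinal.lift.{w} #(I × Fin n) < Cardinal.lift κ := by
    rw [mk_prod, lift_mul]
    refine mul_lt_of_lt (aleph0_le_lift.2 hκ.le) (by simpa using hI) ?_
    simp only [mk_fintype, Fintype.card_fin, lift_natCast]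
    exact (natCast_lt_aleph0).trans_le (aleph0_le_lift.2 hκ.le)
  obtain ⟨F, hF, hFind⟩ := Forking.exists_indiscernible_ultrafilter I
  obtain ⟨c, hc⟩ := hM.saturated.exists_realization hκ.le hB hIn
    (F.map fun g (x : I × Fin n) => a (g x.1) x.2)
  let b : I → Fin n → M := fun i l => c (i, l)
  have hb : ∀ (α : Type) [Finite α] (h : α → I × Fin n) (S : Set (α → M)), B.Definable L S →
      ((fun t => b (h t).1 (h t).2) ∈ S ↔
        ∀ᶠ g in (F : Filter (I → ℕ)), (fun t => a (g (h t).1) (h t).2) ∈ S) :=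
    fun α _ h S hS => hc α (fun t => Sum.inr (h t)) S hS
  have hvb : ∀ i, Forking.tp L B (b i) = Forking.tp L B v := fun i =>
    (Forking.tp_eq_tp_iff.2 fun S hS hv => (hb (Fin n) (fun l => (i, l)) S hS).2
      (Eventually.of_forall fun g => hva (g i) S hS hv)).symm
  refine ⟨b, ⟨hvb, hDFC.not_forks_of_model hM.homogeneous hκ.le hAB
    ((mk_le_mk_of_subset hAB).trans_lt hB)
    (fun k => Forking.not_forks_of_ultrafilter hU (ha k)) hF (fun i k => ?_)
    fun α _ h S hS => (hc α h S hS).1⟩, fun k i j hi hj φ => ?_⟩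
  · exact Forking.tp_eq_tp_mono hAB
      ((Forking.tp_eq_tp_iff.2 fun S hS => hva k S hS).symm.trans (hvb i).symm)
  · have h := fun e : Fin k → I =>
      hb (Fin k × Fin n) (fun x => (e x.1, x.2)) _ (Forking.definable_setOf_realize φ)
    exact (h i).trans ((hFind k i j hi hj fun s => φ.Realize fun x => a (s x.1) x.2).trans
      (h j).symm)
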